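/- Let $\alpha,\beta,\gamma,a,b$ be integers such that $p=\alpha^2a^2+2\beta ab+\gamma b^2$ is a (positive) prime number, and put $m=\alpha^2\gamma-\beta^2$. Then $(x,y,z)=(\alpha,\,b,\,\alpha^2a+\beta b)$ is a nonzero solution of $px^2-my^2=z^2$, i.e. it defines a rational point of the projective curve $px^2-my^2=z^2$. If $m\neq 0$ (so that this curve is a nondegenerate conic), the curve has infinitely many rational points, i.e. there are infinitely many points of $\mathbb{P}^2(\mathbb{Q})$ on it. If, in addition, $m$ and $\alpha$ are (positive) prime numbers with $m\equiv 1\pmod 8$ and $\alpha\equiv 3\pmod 4$, then the equation $px^4-my^4=z^2$ has no nontrivial rational solutions: $x=y=z=0$ is its only solution in rational numbers. -/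

import Mathlib

open scoped LinearAlgebra.Projectivization

/-- The rational points of the projective plane curve `p x² - m y² = z²`, as a set of points of
the projective plane over `ℚ` (proportional solutions are the same point). -/
def conicPoints (p m : ℤ) : Set (ℙ ℚ (Fin 3 → ℚ)) :=
  {P | (p : ℚ) * P.rep 0 ^ 2 - (m : ℚ) * P.rep 1 ^ 2 = P.rep 2 ^ 2}

/-- Membership does not depend on the choice of homogeneous coordinates. -/
theorem mk_mem_conicPoints (p m : ℤ) (v : Fin 3 → ℚ) (hv : v ≠ 0) :
    Projectivization.mk ℚ v hv ∈ conicPoints p m ↔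
      (p : ℚ) * v 0 ^ 2 - (m : ℚ) * v 1 ^ 2 = v 2 ^ 2 := by
  obtain ⟨c, hc⟩ := Projectivization.exists_smul_eq_mk_rep ℚ v hv
  have hc0 : (c : ℚ) ^ 2 ≠ 0 := pow_ne_zero 2 c.ne_zero
  have hrep : ∀ i, (Projectivization.mk ℚ v hv).rep i = (c : ℚ) * v i := by
    intro i
    rw [← hc]
    rfl
  simp only [conicPoints, Set.mem_ofPred_eq, hrep]
  constructor
  · intro h
    apply mul_left_cancel₀ hc0
    linear_combination h
  · intro h
    linear_combination (c : ℚ) ^ 2 * h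

/-!
Put `c = α² a + β b`. The identity `p α² = c² + m b²` gives the point `(α, b, c)` on the conic
`p x² - m y² = z²`. Multiplying `z + y √-m` by elements of norm one moves a rational point with
`x ≠ 0` to infinitely many others (`conicPoints_infinite_of_affine`); if `α = 0`, so that the given
point has `x = 0`, the form `z² - β² y²` is split and another point is written down.

For the quartic, a nontrivial solution may be taken integral with `x`, `y` coprime. Consider the
tangent form to the conic at `(α, b, c)`, evaluated at `(x², y², z)`, and its conjugate:
`A = p α x² - m b y² - c z` and `B = p α x² + m b y² + c z`. They satisfy
`A B = m (b z - c y²)²` and `A + B = 2 p α x²`, and both are positive. A prime other than `m` that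
divides one of them to an odd power divides both, hence is one of `2`, `p`, `α`
(`dvd_of_dvd_tangent_forms`); and `α` divides each of them to the power `0` or `2`
(`tangent_form_valuation`). Let `χ` be the quadratic character modulo `m` of the prime-to-`m` part
(`unitPartChar`). Then `χ 2 = 1` because `m ≡ 1 (mod 8)`, and `χ p = 1` because `p x⁴ ≡ z² (mod m)`
(or `p = m`, where `χ m = 1`), so `χ A = χ B = 1`. As the `m`-adic valuations of `A` and `B` have different parity, the leading
`m`-adic digit of `A + B` is that of `A` or `B`, so `χ (2 p α x²) = 1` and `χ α = 1`. But
`m = α² γ - β²`, `α ≡ 3 (mod 4)` and quadratic reciprocity give `χ α = -1`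
(`legendreSym_eq_neg_one_of_form`).
-/

/-! ### The quadratic character of the prime-to-`M` part -/

/-- The quadratic character modulo the prime `M` of the prime-to-`M` part of a natural number,
as a completely multiplicative function (with value `0` at `0`). -/
noncomputable def unitPartChar (M : ℕ) [Fact M.Prime] : ℕ →* ℤ where
  toFun n := legendreSym M ((n / M ^ n.factorization M : ℕ) : ℤ)
  map_one' := by simp
  map_mul' a b := by
    rw [Nat.ordCompl_mul, Nat.cast_mul, legendreSym.mul]

section UnitPartChar

variable (M : ℕ) [Fact M.Prime]

theorem unitPartChar_self : unitPartChar M M = 1 := by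
  have hM : M.Prime := Fact.out
  change legendreSym M ((M / M ^ M.factorization M : ℕ) : ℤ) = 1
  rw [hM.factorization_self, pow_one, Nat.div_self hM.pos]
  simp

theorem unitPartChar_of_not_dvd {n : ℕ} (hn : ¬ M ∣ n) :
    unitPartChar M n = legendreSym M n := by
  change legendreSym M ((n / M ^ n.factorization M : ℕ) : ℤ) = _
  rw [Nat.factorization_eq_zero_of_not_dvd hn, pow_zero, Nat.div_one]

theorem unitPartChar_sq {n : ℕ} (hn : n ≠ 0) : unitPartChar M n ^ 2 = 1 := by
  have hM : M.Prime := Fact.out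
  apply legendreSym.sq_one
  rw [Int.cast_natCast, Ne, ZMod.natCast_eq_zero_iff]
  exact Nat.not_dvd_ordCompl hM hn

/-- Only the primes of odd exponent contribute to the character. -/
theorem unitPartChar_eq_one {n : ℕ} (hn : n ≠ 0)
    (h : ∀ q : ℕ, q.Prime → Odd (n.factorization q) → unitPartChar M q = 1) :
    unitPartChar M n = 1 := by
  rw [← Nat.prod_factorization_pow_eq_self hn, Finsupp.prod, map_prod]
  refine Finset.prod_eq_one fun q hq => ?_
  have hq' : q.Prime := Nat.prime_of_mem_primeFactors (by simpa using hq)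
  rw [map_pow]
  rcases Nat.even_or_odd (n.factorization q) with ⟨k, hk⟩ | ho
  · rw [hk, ← two_mul, pow_mul, unitPartChar_sq M hq'.ne_zero, one_pow]
  · rw [h q hq' ho, one_pow]

theorem unitPartChar_add_of_lt {A B : ℕ} (hA : A ≠ 0)
    (h : A.factorization M < B.factorization M) :
    unitPartChar M (A + B) = unitPartChar M A := by
  have hM : M.Prime := Fact.out
  obtain ⟨A', hA'⟩ := Nat.ordProj_dvd A M
  have hnd : ¬ M ∣ A' := by
    have := Nat.not_dvd_ordCompl hM hA
    rwa [Nat.div_eq_of_eq_mul_right (pow_pos hM.pos _) hA'] at this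
  obtain ⟨B', hB'⟩ : M ^ (A.factorization M + 1) ∣ B :=
    (pow_dvd_pow M h).trans (Nat.ordProj_dvd B M)
  generalize A.factorization M = k at hA' hB'
  have hnd' : ¬ M ∣ A' + M * B' := fun hd => hnd ((Nat.dvd_add_left (dvd_mul_right M B')).1 hd)
  have hsum : A + B = M ^ k * (A' + M * B') := by rw [hA', hB']; ring
  rw [hsum, hA', map_mul, map_mul, map_pow, unitPartChar_self, one_pow, one_mul, one_mul,
    unitPartChar_of_not_dvd M hnd, unitPartChar_of_not_dvd M hnd', legendreSym.mod M (A' : ℤ),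
    legendreSym.mod]
  congr 1
  push_cast
  simp

/-- Since `A` and `B` have different `M`-adic valuations, the leading `M`-adic digit of `A + B`
is that of `A` or that of `B`. -/
theorem unitPartChar_add_eq_one {A B : ℕ} (hA : A ≠ 0) (hB : B ≠ 0)
    (h : A.factorization M ≠ B.factorization M)
    (hA1 : unitPartChar M A = 1) (hB1 : unitPartChar M B = 1) :
    unitPartChar M (A + B) = 1 := by
  rcases lt_or_gt_of_ne h with h | h
  · rw [unitPartChar_add_of_lt M hA h, hA1]
  · rw [add_comm, unitPartChar_add_of_lt M hB h, hB1]

end UnitPartChar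

/-! ### The tangent form at the known point -/

/-- At the prime `α`, the tangent form `p α x² - m b y² - c z` has valuation `0` or `2`. The second case
occurs when `α ∣ x`, because there `(c z + m b y²)(c z - m b y²) = p (c² x⁴ - m α² y⁴)` has
valuation exactly `2`. -/
theorem tangent_form_valuation {p α b c m x y z : ℤ} (hα : Prime α) (hα2 : ¬ α ∣ 2)
    (hαp : ¬ α ∣ p) (hαm : ¬ α ∣ m) (hαb : ¬ α ∣ b) (hαc : ¬ α ∣ c)
    (hpt : p * α ^ 2 = c ^ 2 + m * b ^ 2) (hxy : IsCoprime x y)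
    (hsol : p * x ^ 4 - m * y ^ 4 = z ^ 2) :
    ∃ n, ¬ α ∣ n ∧ (p * α * x ^ 2 - m * b * y ^ 2 - c * z = n ∨
      p * α * x ^ 2 - m * b * y ^ 2 - c * z = α ^ 2 * n) := by
  by_cases hA : α ∣ p * α * x ^ 2 - m * b * y ^ 2 - c * z
  swap
  · exact ⟨_, hA, Or.inl rfl⟩
  have hT : α ∣ c * z + m * b * y ^ 2 := by
    have : c * z + m * b * y ^ 2
        = α * (p * x ^ 2) - (p * α * x ^ 2 - m * b * y ^ 2 - c * z) := by ring
    rw [this]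
    exact dvd_sub (dvd_mul_right _ _) hA
  have hprod : (c * z + m * b * y ^ 2) * (c * z - m * b * y ^ 2)
      = p * (c ^ 2 * x ^ 4 - m * α ^ 2 * y ^ 4) := by
    linear_combination (-c ^ 2) * hsol + m * y ^ 4 * hpt
  have hx : α ∣ x := by
    have h1 : α ∣ p * (c ^ 2 * x ^ 4) := by
      have : p * (c ^ 2 * x ^ 4) = (c * z + m * b * y ^ 2) * (c * z - m * b * y ^ 2)
          + α * (p * (m * α * y ^ 4)) := by rw [hprod]; ring
      rw [this]
      exact dvd_add (hT.mul_right _) (dvd_mul_right _ _)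
    rcases hα.dvd_or_dvd h1 with h | h
    · exact absurd h hαp
    rcases hα.dvd_or_dvd h with h | h
    · exact absurd (hα.dvd_of_dvd_pow h) hαc
    · exact hα.dvd_of_dvd_pow h
  have hy : ¬ α ∣ y := fun h => hα.not_isUnit (hxy.isUnit_of_dvd' hx h)
  have hT' : ¬ α ∣ c * z - m * b * y ^ 2 := by
    intro h
    have h1 : α ∣ 2 * (m * (b * y ^ 2)) := by
      have := dvd_sub hT h
      ring_nf at this ⊢
      exact this
    rcases hα.dvd_or_dvd h1 with h | h
    · exact hα2 h
    rcases hα.dvd_or_dvd h with h | h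
    · exact hαm h
    rcases hα.dvd_or_dvd h with h | h
    · exact hαb h
    · exact hy (hα.dvd_of_dvd_pow h)
  obtain ⟨x₁, rfl⟩ := hx
  have hTα : α ^ 2 ∣ c * z + m * b * y ^ 2 := by
    refine hα.pow_dvd_of_dvd_mul_right 2 hT' ?_
    rw [hprod]
    exact ⟨p * (c ^ 2 * α ^ 2 * x₁ ^ 4 - m * y ^ 4), by ring⟩
  obtain ⟨t, ht⟩ := hTα
  have ht' : ¬ α ∣ t := by
    intro h
    have h1 : t * (c * z - m * b * y ^ 2) = p * (c ^ 2 * α ^ 2 * x₁ ^ 4 - m * y ^ 4) := by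
      apply mul_left_cancel₀ (pow_ne_zero 2 hα.ne_zero)
      rw [← mul_assoc, ← ht, hprod]
      ring
    have h2 : α ∣ p * (m * y ^ 4) := by
      have : p * (m * y ^ 4)
          = α * (p * c ^ 2 * α * x₁ ^ 4) - t * (c * z - m * b * y ^ 2) := by rw [h1]; ring
      rw [this]
      exact dvd_sub (dvd_mul_right _ _) (h.mul_right _)
    rcases hα.dvd_or_dvd h2 with h | h
    · exact hαp h
    rcases hα.dvd_or_dvd h with h | h
    · exact hαm h
    · exact hy (hα.dvd_of_dvd_pow h)
  refine ⟨α * (p * x₁ ^ 2) - t, fun h => ht' ?_, Or.inr ?_⟩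
  · exact (dvd_sub_right (dvd_mul_right α _)).1 h
  · linear_combination -ht

theorem tangent_form_mul {p α b c m x y z : ℤ} (hpt : p * α ^ 2 = c ^ 2 + m * b ^ 2)
    (hsol : p * x ^ 4 - m * y ^ 4 = z ^ 2) :
    (p * α * x ^ 2 - m * b * y ^ 2 - c * z) * (p * α * x ^ 2 + m * b * y ^ 2 + c * z)
      = m * (b * z - c * y ^ 2) ^ 2 := by
  linear_combination (p * x ^ 4) * hpt + (c ^ 2 + m * b ^ 2) * hsol

/-- A common prime divisor of the tangent form and its conjugate divides `2 m p α`. -/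
theorem dvd_of_dvd_tangent_forms {p α b c m x y z q : ℤ} (hq : Prime q)
    (hpt : p * α ^ 2 = c ^ 2 + m * b ^ 2) (hxy : IsCoprime x y)
    (hsol : p * x ^ 4 - m * y ^ 4 = z ^ 2)
    (hA : q ∣ p * α * x ^ 2 - m * b * y ^ 2 - c * z)
    (hB : q ∣ p * α * x ^ 2 + m * b * y ^ 2 + c * z) :
    q ∣ 2 ∨ q ∣ m ∨ q ∣ p ∨ q ∣ α := by
  by_contra! hcon
  obtain ⟨h2, hm, hp, hα⟩ := hcon
  have hx : q ∣ x := by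
    have h1 : q ∣ 2 * (p * (α * x ^ 2)) := by
      have := dvd_add hA hB
      ring_nf at this ⊢
      exact this
    rcases hq.dvd_or_dvd h1 with h | h
    · exact absurd h h2
    rcases hq.dvd_or_dvd h with h | h
    · exact absurd h hp
    rcases hq.dvd_or_dvd h with h | h
    · exact absurd h hα
    · exact hq.dvd_of_dvd_pow h
  have hW : q ∣ b * z - c * y ^ 2 := by
    have h1 : q ∣ m * (b * z - c * y ^ 2) ^ 2 := by
      rw [← tangent_form_mul hpt hsol]
      exact hA.mul_right _
    rcases hq.dvd_or_dvd h1 with h | h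
    · exact absurd h hm
    · exact hq.dvd_of_dvd_pow h
  have hy : q ∣ p * (α ^ 2 * y ^ 2) := by
    have : p * (α ^ 2 * y ^ 2) = b * (p * α * x ^ 2 + m * b * y ^ 2 + c * z)
        - c * (b * z - c * y ^ 2) - x * (b * p * α * x) := by
      linear_combination y ^ 2 * hpt
    rw [this]
    exact dvd_sub (dvd_sub (hB.mul_left _) (hW.mul_left _)) (hx.mul_right _)
  rcases hq.dvd_or_dvd hy with h | h
  · exact hp h
  rcases hq.dvd_or_dvd h with h | h
  · exact hα (hq.dvd_of_dvd_pow h)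
  · exact hq.not_isUnit (hxy.isUnit_of_dvd' hx (hq.dvd_of_dvd_pow h))

/-! ### Insolubility of the quartic -/

/-- If `AB` is `M` times a nonzero square and the common prime divisors of `A` and `B` which occur
in `A` to an odd power all have trivial character, then `A` has trivial character. -/
theorem unitPartChar_eq_one_of_mul_eq (M : ℕ) [Fact M.Prime] {A B W : ℕ} (hAB : A * B = M * W ^ 2)
    (hA : A ≠ 0) (hB : B ≠ 0) (hW : W ≠ 0)
    (h : ∀ q : ℕ, q.Prime → q ∣ A → q ∣ B → Odd (A.factorization q) → unitPartChar M q = 1) :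
    unitPartChar M A = 1 := by
  have hM : M.Prime := Fact.out
  refine unitPartChar_eq_one M hA fun q hq hodd => ?_
  by_cases hqM : q = M
  · rw [hqM, unitPartChar_self]
  have hf : A.factorization q + B.factorization q = 2 * W.factorization q := by
    have := congrArg (fun n => n.factorization q) hAB
    simp only [Nat.factorization_mul hA hB, Nat.factorization_mul hM.ne_zero (pow_ne_zero 2 hW),
      Nat.factorization_pow, Finsupp.add_apply, Finsupp.smul_apply, smul_eq_mul,
      hM.factorization] at this
    rwa [Finsupp.single_eq_of_ne hqM, zero_add] at this
  refine h q hq (Nat.dvd_of_factorization_pos ?_) (Nat.dvd_of_factorization_pos ?_) hodd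
  · rintro h0; simp [h0] at hodd
  · rintro h0
    rw [h0, add_zero] at hf
    rw [hf] at hodd
    exact (Nat.not_odd_iff_even.2 (even_two_mul _)) hodd

theorem even_factorization_natAbs {A α : ℤ} (hα : Prime α)
    (h : ∃ n, ¬ α ∣ n ∧ (A = n ∨ A = α ^ 2 * n)) :
    Even (A.natAbs.factorization α.natAbs) := by
  have hP : α.natAbs.Prime := Int.prime_iff_natAbs_prime.1 hα
  obtain ⟨n, hn, hA⟩ := h
  have hn' : ¬ α.natAbs ∣ n.natAbs := fun h => hn (Int.natAbs_dvd_natAbs.1 h)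
  have hn0 : n.natAbs ≠ 0 := by
    intro h0
    exact hn' (h0 ▸ dvd_zero _)
  rcases hA with rfl | rfl
  · rw [Nat.factorization_eq_zero_of_not_dvd hn']
    exact Even.zero
  · rw [Int.natAbs_mul, Int.natAbs_pow, Nat.factorization_mul (pow_ne_zero 2 hP.ne_zero) hn0,
      Nat.factorization_pow, Finsupp.add_apply, Finsupp.smul_apply, hP.factorization_self,
      Nat.factorization_eq_zero_of_not_dvd hn']
    decide

/-- Reciprocity: `-m` is a square modulo `α ≡ 3 (mod 4)`, so `m` is not, and hence `α` is not a
square modulo `m ≡ 1 (mod 4)`. -/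
theorem legendreSym_eq_neg_one_of_form {M P : ℕ} [Fact M.Prime] [Fact P.Prime] {β γ : ℤ}
    (hM : M % 4 = 1) (hP : P % 4 = 3) (hform : (M : ℤ) = P ^ 2 * γ - β ^ 2) :
    legendreSym M P = -1 := by
  have hPp : P.Prime := Fact.out
  have hMp : M.Prime := Fact.out
  have hne : M ≠ P := by rintro rfl; omega
  have h0 : ((M : ℤ) : ZMod P) ≠ 0 := by
    rw [Int.cast_natCast, Ne, ZMod.natCast_eq_zero_iff, Nat.prime_dvd_prime_iff_eq hPp hMp]
    exact hne.symm
  have hM' : ((M : ℤ) : ZMod P) = -(β : ZMod P) ^ 2 := by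
    rw [hform]
    push_cast
    simp
  rw [← legendreSym.quadratic_reciprocity_one_mod_four hM (by omega), legendreSym.eq_neg_one_iff]
  rintro ⟨r, hr⟩
  have hβ : (β : ZMod P) ≠ 0 := by
    rintro hβ
    rw [hβ] at hM'
    exact h0 (by simpa using hM')
  have hs : IsSquare (-1 : ZMod P) := by
    refine ⟨r / β, ?_⟩
    rw [div_mul_div_comm, ← hr, hM']
    field_simp
  exact ZMod.exists_sq_eq_neg_one_iff.1 hs hP

/-- If `p x⁴ - m y⁴ = z²` with `x`, `y` coprime, then `p` is a square modulo `m`, or `p = m`. -/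
theorem unitPartChar_eq_one_of_solution {M p : ℕ} [Fact M.Prime] (hp : p.Prime) {x y z : ℤ}
    (hxy : IsCoprime x y) (hsol : p * x ^ 4 - M * y ^ 4 = z ^ 2) : unitPartChar M p = 1 := by
  have hM : M.Prime := Fact.out
  have hM' : Prime (M : ℤ) := Nat.prime_iff_prime_int.1 hM
  by_cases hpM : M = p
  · rw [← hpM, unitPartChar_self]
  have hMp : ¬ M ∣ p := fun h => hpM ((Nat.prime_dvd_prime_iff_eq hM hp).1 h)
  have hMp' : ¬ (M : ℤ) ∣ p := by exact_mod_cast hMp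
  have hx : ¬ (M : ℤ) ∣ x := by
    intro hx
    have hz : (M : ℤ) ∣ z := by
      apply hM'.dvd_of_dvd_pow (n := 2)
      rw [← hsol]
      exact dvd_sub (Dvd.dvd.mul_left (dvd_pow hx (by norm_num)) _) (dvd_mul_right _ _)
    obtain ⟨x', rfl⟩ := hx
    obtain ⟨z', rfl⟩ := hz
    have hy : (M : ℤ) ∣ y ^ 4 := by
      refine ⟨p * M ^ 2 * x' ^ 4 - z' ^ 2, mul_left_cancel₀ hM'.ne_zero ?_⟩
      linear_combination -hsol
    exact hM'.not_isUnit (hxy.isUnit_of_dvd' (dvd_mul_right _ _) (hM'.dvd_of_dvd_pow hy))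
  rw [unitPartChar_of_not_dvd M hMp, legendreSym.eq_one_iff]
  · have hx0 : (x : ZMod M) ≠ 0 := by rwa [Ne, ZMod.intCast_zmod_eq_zero_iff_dvd]
    refine ⟨z / x ^ 2, ?_⟩
    have h := congrArg (Int.cast : ℤ → ZMod M) hsol
    push_cast at h
    rw [CharP.cast_eq_zero (ZMod M) M, zero_mul, sub_zero] at h
    field_simp
    push_cast
    linear_combination h
  · rwa [Int.cast_natCast, Ne, ZMod.natCast_eq_zero_iff]

/-- The quartic has no integral solution with `x` and `y` coprime: the tangent form and its
conjugate have trivial character, but their sum `2 p α x²` has the character of `α`, which is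
`-1`. -/
theorem no_coprime_solution {p M P : ℕ} (hp : p.Prime) (hM : M.Prime) (hP : P.Prime)
    {β γ a b x y z : ℤ} (hpform : (p : ℤ) = P ^ 2 * a ^ 2 + 2 * β * a * b + γ * b ^ 2)
    (hm : (M : ℤ) = P ^ 2 * γ - β ^ 2) (hM8 : M % 8 = 1) (hP4 : P % 4 = 3)
    (hxy : IsCoprime x y) (hsol : p * x ^ 4 - M * y ^ 4 = z ^ 2) : False := by
  have : Fact M.Prime := ⟨hM⟩
  have : Fact P.Prime := ⟨hP⟩
  have hPint : Prime (P : ℤ) := Nat.prime_iff_prime_int.1 hP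
  have hχP : unitPartChar M P = -1 := by
    rw [unitPartChar_of_not_dvd, legendreSym_eq_neg_one_of_form (by omega) hP4 hm]
    rw [Nat.prime_dvd_prime_iff_eq hM hP]
    rintro rfl
    omega
  have hχp : unitPartChar M p = 1 := unitPartChar_eq_one_of_solution hp hxy hsol
  have hχ2 : unitPartChar M 2 = 1 := by
    rw [unitPartChar_of_not_dvd]
    · have := (legendreSym.at_two (p := M) (by omega))
      rw [Nat.cast_ofNat, this, ZMod.χ₈_nat_mod_eight, hM8]
      rfl
    · intro h
      have := Nat.le_of_dvd two_pos h
      have := hM.two_le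
      omega
  have hPp : ¬ (P : ℤ) ∣ p := by
    rw [Int.natCast_dvd_natCast, Nat.prime_dvd_prime_iff_eq hP hp]
    rintro rfl
    rw [hχP] at hχp
    norm_num at hχp
  have hPM : ¬ (P : ℤ) ∣ M := by
    rw [Int.natCast_dvd_natCast, Nat.prime_dvd_prime_iff_eq hP hM]
    rintro rfl
    omega
  have hP2 : ¬ (P : ℤ) ∣ 2 := by
    intro h
    have := Int.le_of_dvd two_pos h
    have := hP.two_le
    omega
  have hPb : ¬ (P : ℤ) ∣ b := by
    intro h
    apply hPp
    rw [hpform]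
    refine dvd_add (dvd_add ?_ (h.mul_left _)) ?_
    · exact (dvd_pow_self _ two_ne_zero).mul_right _
    · exact (dvd_pow h two_ne_zero).mul_left _
  obtain ⟨c, hc⟩ : ∃ c : ℤ, c = P ^ 2 * a + β * b := ⟨_, rfl⟩
  have hpt : (p : ℤ) * P ^ 2 = c ^ 2 + M * b ^ 2 := by
    rw [hpform, hm, hc]
    ring
  have hPc : ¬ (P : ℤ) ∣ c := by
    intro h
    have h1 : (P : ℤ) ∣ M * b ^ 2 := by
      have : (M : ℤ) * b ^ 2 = P * (p * P) - c ^ 2 := by linear_combination -hpt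
      rw [this]
      exact dvd_sub (dvd_mul_right _ _) (dvd_pow h two_ne_zero)
    rcases hPint.dvd_or_dvd h1 with h | h
    · exact hPM h
    · exact hPb (hPint.dvd_of_dvd_pow h)
  -- Changing the sign of `(b, c)` exchanges the tangent form and its conjugate.
  have hvA := tangent_form_valuation hPint hP2 hPp hPM hPb hPc hpt hxy hsol
  have hvB := tangent_form_valuation (b := -b) (c := -c) hPint hP2 hPp hPM (by rwa [dvd_neg])
    (by rwa [dvd_neg]) (by linear_combination hpt) hxy hsol
  have hmul := tangent_form_mul hpt hsol
  have hcommon := fun {q : ℤ} (hq : Prime q) => dvd_of_dvd_tangent_forms hq hpt hxy hsol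
  have hB' : (p : ℤ) * P * x ^ 2 - M * -b * y ^ 2 - -c * z
      = p * P * x ^ 2 + M * b * y ^ 2 + c * z := by ring
  rw [hB'] at hvB
  have hsum : (p * P * x ^ 2 - M * b * y ^ 2 - c * z) + (p * P * x ^ 2 + M * b * y ^ 2 + c * z)
      = 2 * (p : ℤ) * P * x ^ 2 := by ring
  have heA := even_factorization_natAbs hPint hvA
  have heB := even_factorization_natAbs hPint hvB
  rw [Int.natAbs_natCast] at heA heB
  have hne : ∀ {A : ℤ}, (∃ n, ¬ (P : ℤ) ∣ n ∧ (A = n ∨ A = P ^ 2 * n)) → A ≠ 0 := by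
    rintro A ⟨n, hn, rfl | rfl⟩ h0
    · exact hn (h0 ▸ dvd_zero _)
    · rcases mul_eq_zero.1 h0 with h | h
      · exact pow_ne_zero 2 hPint.ne_zero h
      · exact hn (h ▸ dvd_zero _)
  have hA0 := hne hvA
  have hB0 := hne hvB
  generalize (p : ℤ) * P * x ^ 2 - M * b * y ^ 2 - c * z = A at *
  generalize (p : ℤ) * P * x ^ 2 + M * b * y ^ 2 + c * z = B at *
  generalize b * z - c * y ^ 2 = W at *
  have hW0 : W ≠ 0 := by
    rintro rfl
    simp [hA0, hB0] at hmul
  have hAB : A.natAbs * B.natAbs = M * W.natAbs ^ 2 := by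
    rw [← Int.natAbs_mul, hmul, Int.natAbs_mul, Int.natAbs_pow, Int.natAbs_natCast]
  have hMpos : (0 : ℤ) < M := by exact_mod_cast hM.pos
  have hABpos : 0 < A * B := by
    rw [hmul]
    positivity
  have hsumpos : 0 ≤ A + B := by
    rw [hsum]
    positivity
  have hApos : 0 < A := by
    by_contra! h
    nlinarith
  have hBpos : 0 < B := by
    by_contra! h
    nlinarith
  have hχq : ∀ q : ℕ, q.Prime → q ≠ P → q ∣ A.natAbs → q ∣ B.natAbs → unitPartChar M q = 1 := by
    intro q hq hqP hqA hqB
    have h := hcommon (Nat.prime_iff_prime_int.1 hq) (Int.natCast_dvd.2 hqA)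
      (Int.natCast_dvd.2 hqB)
    rw [Int.natCast_dvd_natCast, Int.natCast_dvd_natCast, Int.natCast_dvd_natCast,
      Nat.prime_dvd_prime_iff_eq hq hM, Nat.prime_dvd_prime_iff_eq hq hp,
      Nat.prime_dvd_prime_iff_eq hq hP] at h
    rcases h with h | rfl | rfl | h
    · have h' : q ∣ 2 := by exact_mod_cast h
      rwa [(Nat.prime_dvd_prime_iff_eq hq Nat.prime_two).1 h']
    · exact unitPartChar_self _
    · exact hχp
    · exact absurd h hqP
  have hnA := Int.natAbs_ne_zero.2 hA0
  have hnB := Int.natAbs_ne_zero.2 hB0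
  have hnW := Int.natAbs_ne_zero.2 hW0
  -- A prime other than `M` with odd exponent in one of `A`, `B` divides both, so it is `2`, `p`
  -- or `P`; the exponent of `P` is even.
  have hχA : unitPartChar M A.natAbs = 1 := by
    refine unitPartChar_eq_one_of_mul_eq M hAB hnA hnB hnW fun q hq hqA hqB hodd =>
      hχq q hq ?_ hqA hqB
    rintro rfl
    exact Nat.not_odd_iff_even.2 heA hodd
  have hχB : unitPartChar M B.natAbs = 1 := by
    refine unitPartChar_eq_one_of_mul_eq M ((mul_comm _ _).trans hAB) hnB hnA hnW
      fun q hq hqB hqA hodd => hχq q hq ?_ hqA hqB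
    rintro rfl
    exact Nat.not_odd_iff_even.2 heB hodd
  -- `A B` is `M` times a square, so the two `M`-adic valuations have different parity.
  have hval : A.natAbs.factorization M ≠ B.natAbs.factorization M := by
    intro heq
    have := congrArg (fun n => n.factorization M) hAB
    simp only [Nat.factorization_mul hnA hnB, Nat.factorization_mul hM.ne_zero (pow_ne_zero 2 hnW),
      Nat.factorization_pow, Finsupp.add_apply, Finsupp.smul_apply, smul_eq_mul,
      hM.factorization_self] at this
    omega
  have hχ := unitPartChar_add_eq_one M hnA hnB hval hχA hχB
  have hx0 : x ≠ 0 := by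
    rintro rfl
    rw [zero_pow two_ne_zero, mul_zero] at hsum
    omega
  have hsum' : A.natAbs + B.natAbs = 2 * p * P * x.natAbs ^ 2 := by
    have h := congrArg Int.natAbs hsum
    rw [Int.natAbs_add_of_nonneg hApos.le hBpos.le] at h
    rw [h]
    simp [Int.natAbs_mul, Int.natAbs_pow]
  rw [hsum', map_mul, map_mul, map_mul, map_pow, hχ2, hχp, hχP,
    unitPartChar_sq M (Int.natAbs_ne_zero.2 hx0)] at hχ
  norm_num at hχ

theorem exists_coprime_solution {p m X Y Z : ℤ} (hXY : X ≠ 0 ∨ Y ≠ 0)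
    (h : p * X ^ 4 - m * Y ^ 4 = Z ^ 2) :
    ∃ x y z : ℤ, IsCoprime x y ∧ p * x ^ 4 - m * y ^ 4 = z ^ 2 := by
  have hg : (X.gcd Y : ℤ) ≠ 0 := by
    rw [Nat.cast_ne_zero, Ne, Int.gcd_eq_zero_iff]
    tauto
  obtain ⟨x, hx⟩ := Int.gcd_dvd_left X Y
  obtain ⟨y, hy⟩ := Int.gcd_dvd_right X Y
  have hcop : IsCoprime x y := by
    have h1 := Int.gcd_eq_gcd_ab X Y
    refine ⟨X.gcdA Y, X.gcdB Y, mul_left_cancel₀ hg ?_⟩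
    linear_combination -h1 - X.gcdA Y * hx - X.gcdB Y * hy
  generalize (X.gcd Y : ℤ) = g at *
  obtain ⟨z, rfl⟩ : g ^ 2 ∣ Z := by
    rw [← Int.pow_dvd_pow_iff two_ne_zero, ← h, hx, hy]
    exact ⟨p * x ^ 4 - m * y ^ 4, by ring⟩
  refine ⟨x, y, z, hcop, mul_left_cancel₀ (pow_ne_zero 4 hg) ?_⟩
  rw [hx, hy] at h
  linear_combination h

theorem exists_int_solution {p m : ℤ} {x y z : ℚ} (hxy : x ≠ 0 ∨ y ≠ 0)
    (h : (p : ℚ) * x ^ 4 - m * y ^ 4 = z ^ 2) :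
    ∃ X Y Z : ℤ, (X ≠ 0 ∨ Y ≠ 0) ∧ p * X ^ 4 - m * Y ^ 4 = Z ^ 2 := by
  have hx : x * x.den = x.num := Rat.mul_den_eq_num x
  have hy : y * y.den = y.num := Rat.mul_den_eq_num y
  have hz : z * z.den = z.num := Rat.mul_den_eq_num z
  have hdx := x.den_ne_zero
  have hdy := y.den_ne_zero
  have hdz := z.den_ne_zero
  refine ⟨x.num * y.den * z.den, y.num * x.den * z.den,
    z.num * z.den * x.den ^ 2 * y.den ^ 2, ?_, ?_⟩
  · simpa [hdx, hdy, hdz] using hxy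
  · have : ((p * (x.num * y.den * z.den) ^ 4 - m * (y.num * x.den * z.den) ^ 4 : ℤ) : ℚ)
        = ((z.num * z.den * x.den ^ 2 * y.den ^ 2 : ℤ) : ℚ) ^ 2 := by
      push_cast
      rw [← hx, ← hy, ← hz]
      linear_combination ((x.den : ℚ) * y.den * z.den) ^ 4 * h
    exact_mod_cast this

/-! ### Rational points of the conic -/

/-- A conic with one rational point off the line `x = 0` has infinitely many: the points used
below are images of `(1, y₀, z₀)` under multiplication of `z₀ + y₀ √-m` by the
norm one elements `(1 + t √-m)² / (1 + m t²)`, cleared of denominators. -/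
theorem conicPoints_infinite_of_affine {p m : ℤ} (hp : p ≠ 0) (hm : m ≠ 0) {y₀ z₀ : ℚ}
    (h : (p : ℚ) - m * y₀ ^ 2 = z₀ ^ 2) : (conicPoints p m).Infinite := by
  have hp' : (p : ℚ) ≠ 0 := by exact_mod_cast hp
  have hm' : (m : ℚ) ≠ 0 := by exact_mod_cast hm
  let v : ℕ → Fin 3 → ℚ := fun n =>
    ![1 + m * (n + 2 : ℚ) ^ 2, y₀ * (1 - m * (n + 2 : ℚ) ^ 2) + 2 * z₀ * (n + 2),
      z₀ * (1 - m * (n + 2 : ℚ) ^ 2) - 2 * m * y₀ * (n + 2)]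
  -- An integral parameter `t ≥ 2` cannot satisfy `1 + m t² = 0`, as `t²` would divide `1`.
  have hv0 : ∀ n, v n 0 ≠ 0 := by
    intro n hn
    have h1 : (1 : ℤ) + m * (n + 2 : ℤ) ^ 2 = 0 := by
      have h2 : (1 : ℚ) + m * (n + 2 : ℚ) ^ 2 = 0 := hn
      exact_mod_cast h2
    have h2 : ((n : ℤ) + 2) ∣ 1 := ⟨-(m * (n + 2)), by linear_combination h1⟩
    have := Int.le_of_dvd one_pos h2
    omega
  have hv : ∀ n, v n ≠ 0 := fun n hn => hv0 n (by rw [hn]; rfl)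
  refine Set.infinite_of_injective_forall_mem (f := fun n => Projectivization.mk ℚ (v n) (hv n))
    ?_ ?_
  · intro n k hnk
    obtain ⟨s, hs⟩ := (Projectivization.mk_eq_mk_iff' ℚ _ _ _ _).1 hnk
    have hs0 : s * (1 + m * (k + 2 : ℚ) ^ 2) = 1 + m * (n + 2 : ℚ) ^ 2 := congrFun hs 0
    have hs1 : s * (y₀ * (1 - m * (k + 2 : ℚ) ^ 2) + 2 * z₀ * (k + 2))
        = y₀ * (1 - m * (n + 2 : ℚ) ^ 2) + 2 * z₀ * (n + 2) := congrFun hs 1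
    have hs2 : s * (z₀ * (1 - m * (k + 2 : ℚ) ^ 2) - 2 * m * y₀ * (k + 2))
        = z₀ * (1 - m * (n + 2 : ℚ) ^ 2) - 2 * m * y₀ * (n + 2) := congrFun hs 2
    -- Pairing with `(m y₀, z₀)` isolates `p (1 - m t²)`.
    have hs3 : s * (1 - m * (k + 2 : ℚ) ^ 2) = 1 - m * (n + 2 : ℚ) ^ 2 := by
      apply mul_left_cancel₀ hp'
      linear_combination m * y₀ * hs1 + z₀ * hs2 +
        (s * (1 - m * (k + 2 : ℚ) ^ 2) - (1 - m * (n + 2 : ℚ) ^ 2)) * h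
    have hs4 : s = 1 := by linear_combination (hs0 + hs3) / 2
    have hs5 : ((k : ℚ) + 2) ^ 2 = (n + 2) ^ 2 := by
      apply mul_left_cancel₀ hm'
      rw [hs4] at hs0
      linear_combination hs0
    have hs6 : (k + 2) ^ 2 = (n + 2) ^ 2 := by exact_mod_cast hs5
    have := Nat.pow_left_injective two_ne_zero hs6
    omega
  · intro n
    rw [mk_mem_conicPoints]
    change (p : ℚ) * (1 + m * (n + 2 : ℚ) ^ 2) ^ 2
      - m * (y₀ * (1 - m * (n + 2 : ℚ) ^ 2) + 2 * z₀ * (n + 2)) ^ 2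
      = (z₀ * (1 - m * (n + 2 : ℚ) ^ 2) - 2 * m * y₀ * (n + 2)) ^ 2
    linear_combination (1 + m * (n + 2 : ℚ) ^ 2) ^ 2 * h

theorem theorem3 (p : ℕ) (hp : p.Prime) (α β γ a b m : ℤ)
    (hpform : (p : ℤ) = α ^ 2 * a ^ 2 + 2 * β * a * b + γ * b ^ 2)
    (hm : m = α ^ 2 * γ - β ^ 2) :
    (∃ h : (![(α : ℚ), (b : ℚ), (α : ℚ) ^ 2 * a + β * b] : Fin 3 → ℚ) ≠ 0,
        Projectivization.mk ℚ ![(α : ℚ), (b : ℚ), (α : ℚ) ^ 2 * a + β * b] h ∈ conicPoints p m) ∧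
      (m ≠ 0 → (conicPoints p m).Infinite) ∧
      (0 < m → Prime m → m ≡ 1 [ZMOD 8] → 0 < α → Prime α → α ≡ 3 [ZMOD 4] →
        ∀ x y z : ℚ, (p : ℚ) * x ^ 4 - (m : ℚ) * y ^ 4 = z ^ 2 → x = 0 ∧ y = 0 ∧ z = 0) := by
  have hp0 : (p : ℤ) ≠ 0 := by exact_mod_cast hp.ne_zero
  have hmQ : (m : ℚ) = α ^ 2 * γ - β ^ 2 := by exact_mod_cast hm
  have hpQ : (p : ℚ) = α ^ 2 * a ^ 2 + 2 * β * a * b + γ * b ^ 2 := by exact_mod_cast hpform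
  have hpt : (p : ℚ) * α ^ 2 - m * b ^ 2 = (α ^ 2 * a + β * b) ^ 2 := by
    rw [hmQ, hpQ]
    ring
  refine ⟨?_, ?_, ?_⟩
  · have hne : (![(α : ℚ), (b : ℚ), (α : ℚ) ^ 2 * a + β * b] : Fin 3 → ℚ) ≠ 0 := by
      intro h
      have h0 : (α : ℚ) = 0 := congrFun h 0
      have h1 : (b : ℚ) = 0 := congrFun h 1
      rw [Int.cast_eq_zero] at h0 h1
      rw [h0, h1] at hpform
      exact hp0 (by linear_combination hpform)
    refine ⟨hne, ?_⟩
    rw [mk_mem_conicPoints]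
    exact hpt
  · intro hm0
    by_cases hα : α = 0
    · -- The given point lies on the line `x = 0`, but here `m = -β²`, and
      -- `(z - β y) (z + β y) = p` has the solution `z + β y = p`, `z - β y = 1`.
      have hβ : (β : ℚ) ≠ 0 := by
        rw [Int.cast_ne_zero]
        rintro rfl
        exact hm0 (by rw [hm, hα]; ring)
      refine conicPoints_infinite_of_affine hp0 hm0 (y₀ := (p - 1) / (2 * β))
        (z₀ := (p + 1) / 2) ?_
      rw [hmQ, hα]
      push_cast
      field_simp
      ring
    · have hα' : (α : ℚ) ≠ 0 := by exact_mod_cast hα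
      refine conicPoints_infinite_of_affine hp0 hm0 (y₀ := b / α)
        (z₀ := (α ^ 2 * a + β * b) / α) ?_
      rw [div_pow, div_pow, ← hpt]
      push_cast
      field_simp
  · intro hmpos hmp hm8 hαpos hαp hα4 x y z hsol
    by_cases hxy : x ≠ 0 ∨ y ≠ 0
    · exfalso
      lift m to ℕ using hmpos.le
      lift α to ℕ using hαpos.le
      obtain ⟨X, Y, Z, hXY, hZ⟩ := exists_int_solution (p := p) (m := m) hxy (by exact_mod_cast hsol)
      obtain ⟨x', y', z', hcop, h'⟩ := exists_coprime_solution hXY hZ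
      refine no_coprime_solution hp (Nat.prime_iff_prime_int.2 hmp) (Nat.prime_iff_prime_int.2 hαp)
        hpform hm ?_ ?_ hcop h'
      · unfold Int.ModEq at hm8
        omega
      · unfold Int.ModEq at hα4
        omega
    · rw [not_or, not_not, not_not] at hxy
      obtain ⟨rfl, rfl⟩ := hxy
      refine ⟨rfl, rfl, ?_⟩
      apply pow_eq_zero_iff two_ne_zero |>.1
      rw [← hsol]
      ring
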